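/- **Theorem.** Let $\mathbb F$ be $\mathbb R$ or $\mathbb C$, let $\mathbf A\in\mathbb F^{I\times R}$, $\mathbf B\in\mathbb F^{J\times R}$, $\mathbf C\in\mathbb F^{K\times R}$ have columns $\mathbf a_r,\mathbf b_r,\mathbf c_r$, and let $\mathcal T=[\mathbf A,\mathbf B,\mathbf C]_R\in\mathbb F^{I\times J\times K}$, i.e. $t_{ijk}=\sum_{r=1}^R a_{ir}b_{jr}c_{kr}$. Suppose that $r_{\mathbf C}=K\le R$, where $r_{\mathbf C}$ is the rank of $\mathbf C$, and put $m:=R-K+2$. *Notation.* The rank $r_{\mathcal T}$ is the least number of rank-one tensors $\mathbf a\circ\mathbf b\circ\mathbf c$ (with $\mathbf a,\mathbf b,\mathbf c$ nonzero vectors over $\mathbb F$) whose sum is $\mathcal T$. A decomposition of $\mathcal T$ into $r_{\mathcal T}$ rank-one tensors is a CPD of $\mathcal T$. The CPD is unique if any two CPDs of $\mathcal T$ (written through factor matrices) differ only by a permutation of the terms and by scalings of the three vectors within each term, with product of the three scalars equal to $1$. The $k$-rank $k_{\mathbf M}$ of a matrix $\mathbf M$ is the largest $k$ such that every $k$ columns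 of $\mathbf M$ are linearly independent. $\mathbf A\odot\mathbf B=[\mathbf a_1\otimes\mathbf b_1\ \dots\ \mathbf a_R\otimes\mathbf b_R]$ is the Khatri–Rao product. A matrix has full column rank if its columns are linearly independent. For integers $p\ge 1$, $l\ge 0$, the columns of the matrices $\mathbf\Phi_{p,l}(\mathbf A,\mathbf B)$ and $\mathbf S_{p+l}(\mathbf C)$ are indexed by the tuples $(r_1,\dots,r_{p+l})$ with $1\le r_1\le\dots\le r_{p+l}\le R$ and at least $p$ distinct entries. The rows of $\mathbf\Phi_{p,l}(\mathbf A,\mathbf B)$ are indexed by $(i_1,\dots,i_{p+l};j_1,\dots,j_{p+l})\in\{1,\dots,I\}^{p+l}\times\{1,\dots,J\}^{p+l}$, and its entry is $$\frac1{(p!)^2}\sum_{(s_1,\dots,s_{p+l})}\det\big[a_{i_us_v}\big]_{u,v=1}^p\,\det\big[b_{j_us_v}\big]_{u,v=1}^p\,\prod_{q=1}^{l}a_{i_{p+q}s_{p+q}}b_{j_{p+q}s_{p+q}},$$ where the sum runs over all distinct rearrangements $(s_1,\dots,s_{p+l})$ of $(r_1,\dots,r_{p+l})$, each taken once. The column of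 $\mathbf S_{p+l}(\mathbf C)\in\mathbb F^{K^{p+l}\times\cdots}$ with index $(r_1,\dots,r_{p+l})$ is $$\frac1{(p+l)!}\sum_{\pi}\mathbf c_{r_{\pi(1)}}\otimes\dots\otimes\mathbf c_{r_{\pi(p+l)}},$$ the sum running over all $(p+l)!$ permutations $\pi$ of $\{1,\dots,p+l\}$. *Hypotheses.* Assume that $k_{\mathbf C}\ge1$, that $\mathbf A\odot\mathbf B$ has full column rank, and that at least one of the following holds: 1. there are nonnegative integers $l_1,\dots,l_m$ and, for $p=1,\dots,m$, a matrix $\mathbf U_p$ whose columns form a basis of $\operatorname{range}(\mathbf S_{p+l_p}(\mathbf C)^T)$ such that all the matrices $\mathbf\Phi_{1,l_1}(\mathbf A,\mathbf B)\mathbf U_1,\dots,\mathbf\Phi_{m,l_m}(\mathbf A,\mathbf B)\mathbf U_m$ have full column rank; 2. $\min(k_{\mathbf A},k_{\mathbf B})\ge m-1$, and there are an integer $l\ge0$ and a matrix $\mathbf U_m$ whose columns form a basis of $\operatorname{range}(\mathbf S_{m+l}(\mathbf C)^T)$ such that $\mathbf\Phi_{m,l}(\mathbf A,\mathbf B)\mathbf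 U_m$ has full column rank. Assume moreover that $$\max\big(\min(k_{\mathbf A},k_{\mathbf B}-1),\ \min(k_{\mathbf A}-1,k_{\mathbf B})\big)+k_{\mathbf C}\ge R+1 .$$ *Conclusion.* $r_{\mathcal T}=R$ and the CPD of $\mathcal T$ is unique. -/

import Mathlib

namespace CPD

/-- The tensor `[A, B, C]_R`, with entries `t_{ijk} = ∑ r, a_{ir} b_{jr} c_{kr}`. -/
def polyadic {F : Type*} [Field F] {I J K R : ℕ} (A : Matrix (Fin I) (Fin R) F)
    (B : Matrix (Fin J) (Fin R) F) (C : Matrix (Fin K) (Fin R) F) :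
    Fin I → Fin J → Fin K → F :=
  fun i j k => ∑ r, A i r * B j r * C k r

/-- `T = [A, B, C]_R` is a polyadic decomposition: `T` is the sum of the `R` terms
`a_r ∘ b_r ∘ c_r`, each of which is a rank-one tensor (the three vectors are nonzero). -/
def IsPD {F : Type*} [Field F] {I J K R : ℕ} (T : Fin I → Fin J → Fin K → F)
    (A : Matrix (Fin I) (Fin R) F) (B : Matrix (Fin J) (Fin R) F)
    (C : Matrix (Fin K) (Fin R) F) : Prop :=
  T = polyadic A B C ∧ ∀ r, A.col r ≠ 0 ∧ B.col r ≠ 0 ∧ C.col r ≠ 0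

/-- The rank of a tensor over `F`: the least number of terms of a polyadic decomposition
with factors over `F`. -/
noncomputable def tensorRank {F : Type*} [Field F] {I J K : ℕ}
    (T : Fin I → Fin J → Fin K → F) : ℕ :=
  sInf {n : ℕ | ∃ (A : Matrix (Fin I) (Fin n) F) (B : Matrix (Fin J) (Fin n) F)
    (C : Matrix (Fin K) (Fin n) F), IsPD T A B C}

/-- A canonical polyadic decomposition: one whose number of terms is minimal. -/
def IsCPD {F : Type*} [Field F] {I J K R : ℕ} (T : Fin I → Fin J → Fin K → F)
    (A : Matrix (Fin I) (Fin R) F) (B : Matrix (Fin J) (Fin R) F)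
    (C : Matrix (Fin K) (Fin R) F) : Prop :=
  IsPD T A B C ∧ R = tensorRank T

/-- The CPD of `T` is unique: any two CPDs of `T` differ only by a permutation of the
rank-one terms and by a scaling of the three vectors within each term that keeps the term. -/
def CPDIsUnique {F : Type*} [Field F] {I J K : ℕ} (T : Fin I → Fin J → Fin K → F) : Prop :=
  ∀ (n : ℕ) (A A' : Matrix (Fin I) (Fin n) F) (B B' : Matrix (Fin J) (Fin n) F)
    (C C' : Matrix (Fin K) (Fin n) F), IsCPD T A B C → IsCPD T A' B' C' →
    ∃ (σ : Equiv.Perm (Fin n)) (α β γ : Fin n → F), ∀ r,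
      α r * β r * γ r = 1 ∧ A'.col r = α r • A.col (σ r) ∧
      B'.col r = β r • B.col (σ r) ∧ C'.col r = γ r • C.col (σ r)

/-- The `k`-rank of a matrix: the largest `k` such that every `k` of its columns
are linearly independent. -/
noncomputable def kRank {F : Type*} [Field F] {I R : ℕ} (A : Matrix (Fin I) (Fin R) F) : ℕ :=
  sSup {k : ℕ | k ≤ R ∧ ∀ s : Finset (Fin R), s.card = k →
    LinearIndependent F (fun r : s => A.col r)}

/-- Full column rank: the columns are linearly independent. -/
def FullColumnRank {F : Type*} [Field F] {m n : Type*} (A : Matrix m n F) : Prop :=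
  LinearIndependent F A.col

/-- The Khatri-Rao (columnwise Kronecker) product. -/
def khatriRao {F : Type*} [Field F] {I J R : ℕ} (A : Matrix (Fin I) (Fin R) F)
    (B : Matrix (Fin J) (Fin R) F) : Matrix (Fin I × Fin J) (Fin R) F :=
  Matrix.of fun p r => A p.1 r * B p.2 r

/-- The `(m+l)`-tuples `r_1 ≤ ⋯ ≤ r_{m+l}` in `{1, …, R}` with at least `m` distinct
elements. -/
abbrev Tuple (m l R : ℕ) : Type :=
  {r : Fin (m + l) → Fin R // (∀ p q, p ≤ q → r p ≤ r q) ∧ m ≤ (Finset.univ.image r).card}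

/-- The matrix `Φ_{m,l}(A, B)`. Rows are indexed by
`((i_1, …, i_{m+l}), (j_1, …, j_{m+l}))`. In the column of index `r = (r_1, …, r_{m+l})` the
sum runs over the distinct rearrangements `s = (s_1, …, s_{m+l})` of `r`, each taken once. -/
def Phi {F : Type*} [Field F] {I J R : ℕ} (m l : ℕ) (A : Matrix (Fin I) (Fin R) F)
    (B : Matrix (Fin J) (Fin R) F) :
    Matrix ((Fin (m + l) → Fin I) × (Fin (m + l) → Fin J)) (Tuple m l R) F :=
  Matrix.of fun ij r =>
    (1 / ((m.factorial : F)) ^ 2) *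
      ∑ s ∈ Finset.univ.image (fun π : Equiv.Perm (Fin (m + l)) => r.1 ∘ π),
        (Matrix.of fun p q : Fin m =>
            A (ij.1 (Fin.castAdd l p)) (s (Fin.castAdd l q))).det *
          (Matrix.of fun p q : Fin m =>
            B (ij.2 (Fin.castAdd l p)) (s (Fin.castAdd l q))).det *
          (∏ p : Fin l, A (ij.1 (Fin.natAdd m p)) (s (Fin.natAdd m p))) *
          (∏ p : Fin l, B (ij.2 (Fin.natAdd m p)) (s (Fin.natAdd m p)))

/-- The matrix `S_{m+l}(C)`, whose column of index `(r_1, …, r_{m+l})` is the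
symmetrization of `c_{r_1} ⊗ ⋯ ⊗ c_{r_{m+l}}` (the average over all `(m+l)!` permutations).
Rows are indexed by `(k_1, …, k_{m+l})`. -/
def S {F : Type*} [Field F] {K R : ℕ} (m l : ℕ) (C : Matrix (Fin K) (Fin R) F) :
    Matrix (Fin (m + l) → Fin K) (Tuple m l R) F :=
  Matrix.of fun k r =>
    (1 / ((m + l).factorial : F)) * ∑ π : Equiv.Perm (Fin (m + l)),
      ∏ p : Fin (m + l), C (k p) (r.1 (π p))

/-- The columns of `U` form a basis of the range (column space) of `M`. -/
def ColumnsFormBasisOfRange {F : Type*} [Field F] {n p d : Type*} (U : Matrix n d F)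
    (M : Matrix n p F) : Prop :=
  LinearIndependent F U.col ∧
    Submodule.span F (Set.range U.col) = Submodule.span F (Set.range M.col)

/-- First set of assumptions, with `m = R - K + 2`: for some nonnegative integers
`l_1, …, l_m` all the matrices `Φ_{p,l_p}(A, B) U_p`, `1 ≤ p ≤ m`, have full column rank
(`p : Fin m` stands for the index `p + 1`). -/
def Assumptions₁ {F : Type*} [Field F] {I J K R : ℕ} (A : Matrix (Fin I) (Fin R) F)
    (B : Matrix (Fin J) (Fin R) F) (C : Matrix (Fin K) (Fin R) F) : Prop :=
  1 ≤ kRank C ∧ FullColumnRank (khatriRao A B) ∧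
  ∃ (l d : Fin (R - K + 2) → ℕ)
    (U : ∀ p : Fin (R - K + 2), Matrix (Tuple (p.val + 1) (l p) R) (Fin (d p)) F),
    ∀ p : Fin (R - K + 2),
      ColumnsFormBasisOfRange (U p) (S (p.val + 1) (l p) C).transpose ∧
      FullColumnRank (Phi (p.val + 1) (l p) A B * U p)

/-- Second set of assumptions, with `m = R - K + 2`: `min(k_A, k_B) ≥ m - 1`, and for some
nonnegative integer `l` the matrix `Φ_{m,l}(A, B) U_m` has full column rank. -/
def Assumptions₂ {F : Type*} [Field F] {I J K R : ℕ} (A : Matrix (Fin I) (Fin R) F)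
    (B : Matrix (Fin J) (Fin R) F) (C : Matrix (Fin K) (Fin R) F) : Prop :=
  1 ≤ kRank C ∧ FullColumnRank (khatriRao A B) ∧
  (R - K + 2) - 1 ≤ min (kRank A) (kRank B) ∧
  ∃ (l d : ℕ) (U : Matrix (Tuple (R - K + 2) l R) (Fin d) F),
    ColumnsFormBasisOfRange U (S (R - K + 2) l C).transpose ∧
    FullColumnRank (Phi (R - K + 2) l A B * U)

end CPD

/-! Compare $[A,B,C]_R$ with any decomposition $[A',B',C']_{R'}$ of the same tensor, $R'\le R$. A
functional $f$ on the third mode contracts both to the same matrix,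
$A\,\mathrm{diag}(f(c_r))B^T=A'\,\mathrm{diag}(f(c'_r))B'^T$. If $f$ is nonzero on at most
$m-1=R-K+1$ of the $c'_r$, this matrix has rank below $m$. Its $m\times m$ minors then vanish, so
$\Phi_{m,l}(A,B)$ kills the vector of degree $m+l$ monomials in the numbers $f(c_r)$. That vector
lies in the range of $S_{m+l}(C)^T$, so full column rank of $\Phi_{m,l}(A,B)U_m$ makes it zero, and
$f$ is nonzero on at most $m-1$ of the $c_r$. As $k_A,k_B\ge m-1$, the rank equals that number,
which is therefore at most the number of $r$ with $f(c'_r)\ne0$.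

This is the hypothesis of Kruskal's permutation lemma (`exists_equiv_smul`), which yields $R'=R$ and
$C'=C$ up to permutation and scaling (`third_factor_unique`). Minimality of $R$ follows. The
inequality between $k$-ranks then recovers the other two factors from the common third one
(`exists_scalings_of_third_factor`). -/

namespace CPD

open Module

/-! ### Kruskal's permutation lemma, by counting vectors in flats. -/

section Permutation

variable {F : Type*} [Field F]

/-- The functional dual to `v i` with respect to a family that is independent on `s`. -/
theorem exists_dual_of_linearIndepOn {ι E : Type*} [AddCommGroup E] [Module F E] {v : ι → E}
    {s : Set ι} (hv : LinearIndepOn F v s) {i : ι} (hi : i ∈ s) :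
    ∃ f : Dual F E, f (v i) = 1 ∧ ∀ j ∈ s, j ≠ i → f (v j) = 0 := by
  have hs : v i ∉ Submodule.span F (v '' (s \ {i})) := by
    have h : LinearIndepOn F v (insert i (s \ {i})) := by
      rwa [Set.insert_sdiff_singleton, Set.insert_eq_of_mem hi]
    exact h.notMem_span_of_insert (by simp)
  obtain ⟨f, hf, hle⟩ := Submodule.exists_le_ker_of_notMem hs
  refine ⟨(f (v i))⁻¹ • f, by simp [hf], fun j hj hji => ?_⟩
  have : f (v j) = 0 := hle (Submodule.subset_span ⟨j, ⟨hj, hji⟩, rfl⟩)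
  simp [this]

open Classical in
/-- The number of members of the family `c` that lie in the subspace `V`. -/
noncomputable def flatCard {E : Type*} [AddCommGroup E] [Module F E] {R : ℕ} (c : Fin R → E)
    (V : Submodule F E) : ℕ :=
  (Finset.univ.filter fun r => c r ∈ V).card

variable {E : Type*} [AddCommGroup E] [Module F E] {R R' : ℕ}

open Classical in
theorem flatCard_add_card_notMem (c : Fin R → E) (V : Submodule F E) :
    flatCard c V + (Finset.univ.filter fun r => c r ∉ V).card = R := by
  simpa [flatCard] using
    Finset.card_filter_add_card_filter_not (s := (Finset.univ : Finset (Fin R))) (fun r => c r ∈ V)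

open Classical in
theorem card_mem_diff (c : Fin R → E) {V W : Submodule F E} (h : V ≤ W) :
    flatCard c V + (Finset.univ.filter fun r => c r ∈ W ∧ c r ∉ V).card = flatCard c W := by
  have := Finset.card_filter_add_card_filter_not
    (s := Finset.univ.filter fun r => c r ∈ W) (fun r => c r ∈ V)
  rw [Finset.filter_filter, Finset.filter_filter] at this
  unfold flatCard
  rw [← this]
  congr 2
  ext r
  simpa using fun hr => h hr

/-- A flat of the family `c'` is the span of the members of `c'` it contains. -/
def IsFlat (c' : Fin R' → E) (V : Submodule F E) : Prop :=
  V ≤ Submodule.span F (c' '' {r | c' r ∈ V})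

theorem IsFlat.sup_span {c' : Fin R' → E} {V : Submodule F E} (hV : IsFlat c' V) (r : Fin R') :
    IsFlat c' (V ⊔ Submodule.span F {c' r}) := by
  refine sup_le (hV.trans (Submodule.span_mono (Set.image_mono fun s hs =>
    Submodule.mem_sup_left hs))) ?_
  rw [Submodule.span_singleton_le_iff_mem]
  exact Submodule.subset_span
    ⟨r, Submodule.mem_sup_right (Submodule.mem_span_singleton_self _), rfl⟩

theorem IsFlat.finrank_le [FiniteDimensional F E] {c' : Fin R' → E} {V : Submodule F E}
    (hV : IsFlat c' V) : finrank F V ≤ flatCard c' V := by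
  classical
  have h := finrank_span_finset_le_card (R := F)
    ((Finset.univ.filter fun r => c' r ∈ V).image c')
  have hset : (((Finset.univ.filter fun r => c' r ∈ V).image c' : Finset E) : Set E) =
      c' '' {r | c' r ∈ V} := by
    simp
  rw [Set.finrank, hset] at h
  exact (Submodule.finrank_mono hV).trans (h.trans Finset.card_image_le)

theorem sup_span_singleton_eq [FiniteDimensional F E] {V W : Submodule F E} {x : E}
    (hVW : V ≤ W) (hW : finrank F W = finrank F V + 1) (hxV : x ∉ V) (hxW : x ∈ W) :
    V ⊔ Submodule.span F {x} = W := by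
  refine Submodule.eq_of_le_of_finrank_eq
    (sup_le hVW ((Submodule.span_singleton_le_iff_mem _ _).2 hxW)) ?_
  rw [Submodule.finrank_sup_span_singleton hxV, hW]

/-- The induction step of the permutation lemma, from flats of dimension `d + 1` to a flat
of dimension `d`. -/
theorem flatCard_le_step [FiniteDimensional F E] {c : Fin R → E} {c' : Fin R' → E}
    (hspan : Submodule.span F (Set.range c') = ⊤) (hR : R' ≤ R) {V : Submodule F E}
    (hV : IsFlat c' V) (hd : finrank F V + 2 ≤ finrank F E)
    (ih : ∀ W : Submodule F E, IsFlat c' W → finrank F W = finrank F V + 1 →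
      flatCard c' W + (R - R') ≤ flatCard c W) :
    flatCard c' V + (R - R') ≤ flatCard c V := by
  classical
  set g : Fin R' → Submodule F E := fun r => V ⊔ Submodule.span F {c' r} with hg
  set N := Finset.univ.filter fun r => c' r ∉ V with hN
  set 𝒲 := N.image g with h𝒲
  have hW : ∀ W ∈ 𝒲, V ≤ W ∧ IsFlat c' W ∧ finrank F W = finrank F V + 1 := by
    intro W hW
    obtain ⟨r, hr, rfl⟩ := Finset.mem_image.1 hW
    exact ⟨le_sup_left, hV.sup_span r, Submodule.finrank_sup_span_singleton (by simpa [hN] using hr)⟩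
  -- The flats in `𝒲` partition the members of `c'` outside `V`. For `c` they are only disjoint
  -- outside `V`, which gives the inequality `hc`.
  have hc' : N.card = ∑ W ∈ 𝒲, (Finset.univ.filter fun r => c' r ∈ W ∧ c' r ∉ V).card := by
    rw [Finset.card_eq_sum_card_image g N]
    refine Finset.sum_congr rfl fun W hW' => congrArg _ ?_
    obtain ⟨hVW, -, hdim⟩ := hW W hW'
    ext r
    simp only [hN, Finset.mem_filter, Finset.mem_univ, true_and]
    constructor
    · rintro ⟨h1, rfl⟩
      exact ⟨Submodule.mem_sup_right (Submodule.mem_span_singleton_self _), h1⟩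
    · rintro ⟨h1, h2⟩
      exact ⟨h2, sup_span_singleton_eq hVW hdim h2 h1⟩
  have hc : ∑ W ∈ 𝒲, (Finset.univ.filter fun r => c r ∈ W ∧ c r ∉ V).card ≤
      (Finset.univ.filter fun r => c r ∉ V).card := by
    rw [← Finset.card_biUnion]
    · refine Finset.card_le_card fun r hr => ?_
      obtain ⟨W, -, h⟩ := Finset.mem_biUnion.1 hr
      simpa using (Finset.mem_filter.1 h).2.2
    · intro W hW1 W' hW2 hne
      refine Finset.disjoint_left.2 fun r h1 h2 => hne ?_
      obtain ⟨-, h1, hr⟩ := Finset.mem_filter.1 h1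
      obtain ⟨-, h2, -⟩ := Finset.mem_filter.1 h2
      rw [← sup_span_singleton_eq (hW W hW1).1 (hW W hW1).2.2 hr h1,
        sup_span_singleton_eq (hW W' hW2).1 (hW W' hW2).2.2 hr h2]
  -- With at most one such flat, `c'` would span dimension at most `finrank F V + 1`, less than that
  -- of `E`.
  have hcard : 2 ≤ 𝒲.card := by
    by_contra hlt
    have hle : 𝒲.card ≤ 1 := by omega
    rw [Finset.card_le_one] at hle
    obtain ⟨W, hVW, hmem, hdim⟩ : ∃ W, V ≤ W ∧ (∀ r, c' r ∈ W) ∧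
        finrank F W ≤ finrank F V + 1 := by
      by_cases hne : 𝒲.Nonempty
      · obtain ⟨W, hW'⟩ := hne
        refine ⟨W, (hW W hW').1, fun r => ?_, (hW W hW').2.2.le⟩
        by_cases hr : c' r ∈ V
        · exact (hW W hW').1 hr
        · rw [hle W hW' (g r) (Finset.mem_image_of_mem _ (by simpa [hN] using hr))]
          exact Submodule.mem_sup_right (Submodule.mem_span_singleton_self _)
      · refine ⟨V, le_rfl, fun r => ?_, by omega⟩
        by_contra hr
        exact hne ⟨g r, Finset.mem_image_of_mem _ (by simpa [hN] using hr)⟩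
    have htop : W = ⊤ := by
      rw [eq_top_iff, ← hspan, Submodule.span_le]
      rintro _ ⟨r, rfl⟩
      exact hmem r
    rw [htop, finrank_top] at hdim
    omega
  have hsum : ∑ W ∈ 𝒲, (flatCard c' V + (Finset.univ.filter fun r => c' r ∈ W ∧ c' r ∉ V).card
      + (R - R')) ≤
      ∑ W ∈ 𝒲, (flatCard c V + (Finset.univ.filter fun r => c r ∈ W ∧ c r ∉ V).card) :=
    Finset.sum_le_sum fun W hW' => by
      rw [card_mem_diff c' (hW W hW').1, card_mem_diff c (hW W hW').1]
      exact ih W (hW W hW').2.1 (hW W hW').2.2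
  simp only [Finset.sum_add_distrib, Finset.sum_const, smul_eq_mul] at hsum
  rw [← hc'] at hsum
  have h1 := flatCard_add_card_notMem c V
  have h2 := flatCard_add_card_notMem c' V
  rw [← hN] at h2
  obtain ⟨t, ht⟩ := Nat.exists_eq_add_of_le hcard
  rw [ht] at hsum
  obtain ⟨e, rfl⟩ := Nat.exists_eq_add_of_le hR
  simp only [Nat.add_sub_cancel_left] at hsum ⊢
  -- Here `t + 1` is `𝒲.card - 1`: summing `ih` over `𝒲` and rewriting the outside counts as
  -- complements cancels one copy of each count on `V`. The factor is positive because `𝒲` has at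
  -- least two members.
  have : (t + 1) * (flatCard c' V + e) ≤ (t + 1) * flatCard c V := by nlinarith
  exact Nat.le_of_mul_le_mul_left this (by omega)

-- Induction on codimension. On the whole space it is the count $R'+(R-R')=R$; a hyperplane is the
-- kernel of a functional, to which `h` applies; from codimension two on, `flatCard_le_step`
-- descends.
open Classical in
theorem flatCard_add_le [FiniteDimensional F E] {c : Fin R → E} {c' : Fin R' → E}
    (hspan : Submodule.span F (Set.range c') = ⊤) (hR : R' ≤ R)
    (h : ∀ f : Dual F E,
      (Finset.univ.filter fun r => f (c' r) ≠ 0).card + finrank F E ≤ R' + 1 →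
      (Finset.univ.filter fun r => f (c r) ≠ 0).card ≤
        (Finset.univ.filter fun r => f (c' r) ≠ 0).card) {V : Submodule F E}
    (hV : IsFlat c' V) : flatCard c' V + (R - R') ≤ flatCard c V := by
  obtain ⟨k, hk⟩ := Nat.exists_eq_add_of_le (Submodule.finrank_le V)
  induction k generalizing V with
  | zero =>
    obtain rfl := Submodule.eq_top_of_finrank_eq hk.symm
    simp only [flatCard, Submodule.mem_top, Finset.filter_true, Finset.card_univ,
      Fintype.card_fin]
    omega
  | succ k ih =>
    rcases Nat.eq_zero_or_pos k with rfl | hk0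
    · have hlt : V < ⊤ := lt_top_iff_ne_top.2 fun hT => by
        rw [hT, finrank_top] at hk
        omega
      obtain ⟨x, -, hx⟩ := SetLike.exists_of_lt hlt
      obtain ⟨f, hf, hle⟩ := Submodule.exists_le_ker_of_notMem hx
      have hker : V = LinearMap.ker f := by
        refine Submodule.eq_of_le_of_finrank_le hle ?_
        have : finrank F (LinearMap.ker f) < finrank F E := Submodule.finrank_lt fun hT => hf <| by
          rw [← LinearMap.mem_ker, hT]
          trivial
        omega
      have e1 := flatCard_add_card_notMem c V
      have e2 := flatCard_add_card_notMem c' V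
      -- A flat hyperplane contains at least `finrank F E - 1` members of `c'`, so `f` is nonzero on
      -- few enough of them for `h` to apply.
      have e3 := hV.finrank_le
      have e4 := h f
      simp only [hker, LinearMap.mem_ker] at *
      simp only [ne_eq] at e4
      have e5 := e4 (by omega)
      omega
    · exact flatCard_le_step hspan hR hV (by omega) fun W hW hdim => ih hW (by omega)

open Classical in
/-- **Kruskal's permutation lemma**, for a family `c` of pairwise independent vectors. -/
theorem exists_equiv_smul [FiniteDimensional F E] {c : Fin R → E} {c' : Fin R' → E}
    (hspan : Submodule.span F (Set.range c') = ⊤) (hR : R' ≤ R) (hc0 : ∀ r, c r ≠ 0)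
    (hc : ∀ r s, ∀ x : E, c r ∈ Submodule.span F {x} → c s ∈ Submodule.span F {x} → r = s)
    (h : ∀ f : Dual F E,
      (Finset.univ.filter fun r => f (c' r) ≠ 0).card + finrank F E ≤ R' + 1 →
      (Finset.univ.filter fun r => f (c r) ≠ 0).card ≤
        (Finset.univ.filter fun r => f (c' r) ≠ 0).card) :
    R' = R ∧ ∃ σ : Fin R' → Fin R, Function.Injective σ ∧
      ∀ r, ∃ γ : F, γ ≠ 0 ∧ c' r = γ • c (σ r) := by
  -- No `c r` lies in the zero space, so this one inequality forces both `R' = R` and that no `c' r`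
  -- is zero.
  have hbot := flatCard_add_le hspan hR h (V := ⊥) (by simp [IsFlat])
  have hc_bot : flatCard c (⊥ : Submodule F E) = 0 := by simp [flatCard, hc0]
  have hRR : R' = R := by omega
  refine ⟨hRR, ?_⟩
  have hc0' : ∀ r, c' r ≠ 0 := by
    have : flatCard c' (⊥ : Submodule F E) = 0 := by omega
    simpa [flatCard, Finset.filter_eq_empty_iff] using this
  have hline : ∀ r, flatCard c' (Submodule.span F {c' r}) ≤ flatCard c (Submodule.span F {c' r}) :=
    fun r => le_trans (Nat.le_add_right _ _) <| flatCard_add_le hspan hR h <| by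
      rw [IsFlat, Submodule.span_singleton_le_iff_mem]
      exact Submodule.subset_span ⟨r, Submodule.mem_span_singleton_self _, rfl⟩
  have hex : ∀ r, ∃ s, c s ∈ Submodule.span F {c' r} := fun r => by
    have h1 : 0 < flatCard c' (Submodule.span F {c' r}) :=
      Finset.card_pos.2 ⟨r, by simp [Submodule.mem_span_singleton_self]⟩
    obtain ⟨s, hs⟩ := Finset.card_pos.1 (h1.trans_le (hline r))
    exact ⟨s, (Finset.mem_filter.1 hs).2⟩
  choose σ hσ using hex
  have hscal : ∀ r, ∃ γ : F, γ ≠ 0 ∧ c' r = γ • c (σ r) := fun r => by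
    obtain ⟨a, ha⟩ := Submodule.mem_span_singleton.1 (hσ r)
    have ha0 : a ≠ 0 := by
      rintro rfl
      exact hc0 (σ r) (by rw [← ha, zero_smul])
    exact ⟨a⁻¹, inv_ne_zero ha0, by rw [← ha, smul_smul, inv_mul_cancel₀ ha0, one_smul]⟩
  refine ⟨σ, fun r s hrs => ?_, hscal⟩
  have h1 : flatCard c (Submodule.span F {c' r}) ≤ 1 := Finset.card_le_one.2 fun i hi j hj =>
    hc i j _ (Finset.mem_filter.1 hi).2 (Finset.mem_filter.1 hj).2
  refine Finset.card_le_one.1 ((hline r).trans h1) r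
    (by simp [Submodule.mem_span_singleton_self]) s ?_
  obtain ⟨a, ha, hr⟩ := hscal r
  obtain ⟨b, hb, hs⟩ := hscal s
  simp only [Finset.mem_filter, Finset.mem_univ, true_and]
  rw [hs, hr, hrs]
  exact Submodule.mem_span_singleton.2 ⟨b * a⁻¹, by
    rw [smul_smul, mul_assoc, inv_mul_cancel₀ ha, mul_one]⟩

end Permutation

/-! ### Consequences of a lower bound on the k-rank. -/

section KRank

variable {F : Type*} [Field F]

theorem kRank_spec {I R : ℕ} (A : Matrix (Fin I) (Fin R) F) :
    kRank A ≤ R ∧ ∀ s : Finset (Fin R), s.card = kRank A →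
      LinearIndependent F (fun r : s => A.col r) := by
  refine Nat.sSup_mem (s := {k : ℕ | k ≤ R ∧ ∀ s : Finset (Fin R), s.card = k →
    LinearIndependent F (fun r : s => A.col r)}) ⟨0, Nat.zero_le _, fun s hs => ?_⟩
    ⟨R, fun k hk => hk.1⟩
  obtain rfl := Finset.card_eq_zero.1 hs
  exact linearIndependent_empty_type

theorem linearIndepOn_of_card_le_kRank {I R : ℕ} {A : Matrix (Fin I) (Fin R) F}
    {s : Finset (Fin R)} (hs : s.card ≤ kRank A) : LinearIndepOn F A.col (s : Set (Fin R)) := by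
  obtain ⟨t, hst, -, ht⟩ := Finset.exists_subsuperset_card_eq (Finset.subset_univ s) hs
    (by simpa using (kRank_spec A).1)
  exact LinearIndepOn.mono ((kRank_spec A).2 t ht) (Finset.coe_subset.2 hst)

theorem kRank_le_height {I R : ℕ} (A : Matrix (Fin I) (Fin R) F) : kRank A ≤ I := by
  obtain ⟨t, -, ht⟩ := Finset.exists_subset_card_eq
    (s := (Finset.univ : Finset (Fin R))) (by simpa using (kRank_spec A).1)
  simpa [ht] using ((kRank_spec A).2 t ht).fintype_card_le_finrank

theorem col_ne_zero_of_one_le_kRank {I R : ℕ} {A : Matrix (Fin I) (Fin R) F} (h : 1 ≤ kRank A)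
    (r : Fin R) : A.col r ≠ 0 :=
  (linearIndepOn_of_card_le_kRank (A := A) (s := {r}) (by simpa)).ne_zero (by simp)

theorem eq_of_mem_span_singleton_of_two_le_kRank {I R : ℕ} {A : Matrix (Fin I) (Fin R) F}
    (h : 2 ≤ kRank A) (r s : Fin R) (x : Fin I → F) (hr : A.col r ∈ Submodule.span F {x})
    (hs : A.col s ∈ Submodule.span F {x}) : r = s := by
  by_contra hne
  have hi := linearIndepOn_of_card_le_kRank (A := A) (s := {r, s})
    (by rwa [Finset.card_pair hne])
  obtain ⟨f, hf, hf0⟩ := exists_dual_of_linearIndepOn hi (i := r) (by simp)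
  obtain ⟨a, ha⟩ := Submodule.mem_span_singleton.1 hr
  obtain ⟨b, hb⟩ := Submodule.mem_span_singleton.1 hs
  have h0 := hf0 s (by simp) (Ne.symm hne)
  rw [← ha, map_smul, smul_eq_mul] at hf
  rw [← hb, map_smul, smul_eq_mul, mul_eq_zero] at h0
  have hs0 := col_ne_zero_of_one_le_kRank (A := A) (by omega) s
  rcases h0 with h0 | h0
  · exact hs0 (by rw [← hb, h0, zero_smul])
  · simp [h0] at hf

end KRank

/-! ### Recovering two factors when the third is known. -/

section Factors

variable {F : Type*} [Field F] {E₁ E₂ E₃ : Type*} [AddCommGroup E₁] [Module F E₁]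
  [AddCommGroup E₂] [Module F E₂] [AddCommGroup E₃] [Module F E₃] {R : ℕ}

/-- If `n` vectors that are linearly independent lie in the span of `n` vectors, then the spans
agree. -/
theorem mem_span_image_of_le {b b' : Fin R → E₂} {s : Finset (Fin R)}
    (hb : LinearIndepOn F b (s : Set (Fin R)))
    (h : ∀ i ∈ s, b i ∈ Submodule.span F (b' '' (s : Set (Fin R)))) {r : Fin R} (hr : r ∈ s) :
    b' r ∈ Submodule.span F (b '' (s : Set (Fin R))) := by
  classical
  have hle : Submodule.span F (b '' (s : Set (Fin R))) ≤
      Submodule.span F (b' '' (s : Set (Fin R))) := by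
    rw [Submodule.span_le]
    rintro _ ⟨i, hi, rfl⟩
    exact h i hi
  have hfin : (b' '' (s : Set (Fin R))).Finite := s.finite_toSet.image _
  have : FiniteDimensional F (Submodule.span F (b' '' (s : Set (Fin R)))) :=
    FiniteDimensional.span_of_finite F hfin
  have h1 : finrank F (Submodule.span F (b '' (s : Set (Fin R)))) = s.card := by
    have := finrank_span_eq_card hb
    rw [← Set.image_eq_range] at this
    simpa using this
  have h2 : finrank F (Submodule.span F (b' '' (s : Set (Fin R)))) ≤ s.card := by
    have := finrank_span_finset_le_card (R := F) (s.image b')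
    rw [Set.finrank, Finset.coe_image] at this
    exact this.trans Finset.card_image_le
  rw [Submodule.eq_of_le_of_finrank_le hle (h2.trans h1.ge)]
  exact Submodule.subset_span ⟨r, hr, rfl⟩

/-- A vector that lies in all the spans of `q` vectors containing `b r`, out of `q + 1`
independent vectors, is a multiple of `b r`. -/
theorem exists_smul_of_forall_mem_span {b : Fin R → E₂} {G : Finset (Fin R)}
    (hb : LinearIndepOn F b (G : Set (Fin R))) {r : Fin R} (hr : r ∈ G) {x : E₂}
    (hG : x ∈ Submodule.span F (b '' (G : Set (Fin R))))
    (h : ∀ i ∈ G, i ≠ r → x ∈ Submodule.span F (b '' (G.erase i : Set (Fin R)))) :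
    ∃ β : F, x = β • b r := by
  classical
  obtain ⟨y, hy⟩ : ∃ y : Fin R → F, x = ∑ i ∈ G, y i • b i := by
    obtain ⟨y, hy⟩ := (Submodule.mem_span_image_finset_iff_exists_fun F).1 hG
    refine ⟨fun i => if h : i ∈ G then y ⟨i, h⟩ else 0, ?_⟩
    rw [← hy, ← Finset.sum_coe_sort G]
    exact Finset.sum_congr rfl fun i _ => by simp
  refine ⟨y r, ?_⟩
  rw [hy]
  refine Finset.sum_eq_single_of_mem r hr fun i hi hir => ?_
  obtain ⟨f, hf, hf0⟩ := exists_dual_of_linearIndepOn hb hi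
  have hx : f x = 0 := by
    have hle : Submodule.span F (b '' (G.erase i : Set (Fin R))) ≤ LinearMap.ker f := by
      rw [Submodule.span_le]
      rintro _ ⟨j, hj, rfl⟩
      have := Finset.mem_erase.1 hj
      exact hf0 j this.2 this.1
    exact hle (h i hi hir)
  have : f x = y i := by
    rw [hy, map_sum, Finset.sum_eq_single_of_mem i hi]
    · simp [hf]
    · intro j hj hji
      simp [hf0 j hj hji]
  rw [← this, hx, zero_smul]

/-- If a tensor has two decompositions with the same third factor, then under a bound on the
independence of the columns of the factors they have the same terms. -/
theorem exists_scalars_of_third_factor_eq {a a' : Fin R → E₁} {b b' : Fin R → E₂} {c : Fin R → E₃}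
    {q : ℕ} (hq : 1 ≤ q) (hqR : q + 1 ≤ R)
    (ha : ∀ s : Finset (Fin R), s.card ≤ q → LinearIndepOn F a (s : Set (Fin R)))
    (hb : ∀ s : Finset (Fin R), s.card ≤ q + 1 → LinearIndepOn F b (s : Set (Fin R)))
    (hc : ∀ s : Finset (Fin R), s.card + q ≤ R + 1 → LinearIndepOn F c (s : Set (Fin R)))
    (h : ∀ (f : Dual F E₃) (g : Dual F E₁),
      ∑ s, (f (c s) * g (a s)) • b s = ∑ s, (f (c s) * g (a' s)) • b' s) :
    ∃ β : Fin R → F, ∀ r, β r ≠ 0 ∧ b' r = β r • b r ∧ a r = β r • a' r := by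
  classical
  -- The complement of `s` together with `e` has `R + 1 - q` elements, exactly the size up to which
  -- `c` is independent.
  have hdual : ∀ s : Finset (Fin R), s.card = q → ∀ e ∈ s,
      ∃ f : Dual F E₃, f (c e) = 1 ∧ ∀ i ∉ s, f (c i) = 0 := by
    intro s hs e he
    have hcard : (insert e sᶜ).card + q ≤ R + 1 := by
      rw [Finset.card_insert_of_notMem (by simpa using he), Finset.card_compl, Fintype.card_fin]
      omega
    obtain ⟨f, hf, hf0⟩ := exists_dual_of_linearIndepOn (hc _ hcard) (i := e) (by simp)
    refine ⟨f, hf, fun i hi => hf0 i (by simp [hi]) ?_⟩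
    rintro rfl
    exact hi he
  have hmem : ∀ s : Finset (Fin R), s.card = q → ∀ r ∈ s,
      b' r ∈ Submodule.span F (b '' (s : Set (Fin R))) := by
    intro s hs r hr
    refine mem_span_image_of_le (hb s (by omega)) (fun e he => ?_) hr
    obtain ⟨f, hf, hf0⟩ := hdual s hs e he
    obtain ⟨g, hg, hg0⟩ := exists_dual_of_linearIndepOn (ha s hs.le) he
    -- On the left `f` kills the terms outside `s` and `g` those in `s` other than `e`, leaving `b
    -- e`; on the right only terms with index in `s` survive.
    have key := h f g
    rw [Finset.sum_eq_single e, hf, hg, one_mul, one_smul] at key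
    · rw [key]
      refine Submodule.sum_mem _ fun i _ => ?_
      by_cases hi : i ∈ s
      · exact Submodule.smul_mem _ _ (Submodule.subset_span ⟨i, hi, rfl⟩)
      · simp [hf0 i hi]
    · intro i _ hie
      by_cases hi : i ∈ s
      · simp [hg0 i hi hie]
      · simp [hf0 i hi]
    · simp
  have hβ : ∀ r, ∃ β : F, b' r = β • b r := by
    intro r
    -- The q-subsets of `G` containing `r` meet only in `r`, so by independence of `b` on `G` the
    -- corresponding spans meet in the line of `b r`.
    obtain ⟨G, hrG, -, hG⟩ := Finset.exists_subsuperset_card_eq (n := q + 1)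
      (Finset.subset_univ {r}) (by simp) (by simpa using hqR)
    have hr : r ∈ G := hrG (Finset.mem_singleton_self r)
    have herase : ∀ i ∈ G, i ≠ r →
        b' r ∈ Submodule.span F (b '' (G.erase i : Set (Fin R))) := fun i hi hir =>
      hmem _ (by rw [Finset.card_erase_of_mem hi, hG]; omega) r
        (Finset.mem_erase.2 ⟨Ne.symm hir, hr⟩)
    refine exists_smul_of_forall_mem_span (hb G hG.le) hr ?_ herase
    obtain ⟨i, hi, hir⟩ := Finset.exists_mem_ne (by omega : 1 < G.card) r
    exact Submodule.span_mono (Set.image_mono (Finset.coe_subset.2 (Finset.erase_subset _ _)))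
      (herase i hi hir)
  choose β hβ using hβ
  have hab : ∀ r, a r = β r • a' r := by
    intro r
    obtain ⟨s, hrs, -, hs⟩ := Finset.exists_subsuperset_card_eq (n := q)
      (Finset.subset_univ {r}) (by simpa) (by simp; omega)
    have hr : r ∈ s := hrs (Finset.mem_singleton_self r)
    obtain ⟨f, hf, hf0⟩ := hdual s hs r hr
    obtain ⟨p, hp, hp0⟩ := exists_dual_of_linearIndepOn (hb s (by omega)) hr
    have hother : ∀ i, i ≠ r → f (c i) = 0 ∨ p (b i) = 0 := fun i hi => by
      by_cases his : i ∈ s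
      · exact Or.inr (hp0 i his hi)
      · exact Or.inl (hf0 i his)
    rw [← sub_eq_zero, ← Module.forall_dual_apply_eq_zero_iff F]
    intro g
    -- Since `b' i` is now a multiple of `b i`, the functional `p` isolates the term `r` on both
    -- sides.
    have key := congrArg p (h f g)
    rw [map_sum, map_sum, Finset.sum_eq_single r, Finset.sum_eq_single r] at key
    · simp only [hβ, map_smul, smul_eq_mul, hf, hp, mul_one, one_mul] at key
      rw [map_sub, map_smul, smul_eq_mul, key]
      ring
    · intro i _ hi
      rcases hother i hi with h0 | h0 <;> simp [hβ, h0]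
    · simp
    · intro i _ hi
      rcases hother i hi with h0 | h0 <;> simp [h0]
    · simp
  refine ⟨β, fun r => ⟨fun h0 => ?_, hβ r, hab r⟩⟩
  refine (ha {r} (by simpa)).ne_zero (i := r) (by simp) ?_
  rw [hab, h0, zero_smul]

end Factors

/-! ### The matrices Φ and S, and ranks of contractions. -/

section CompoundMatrices

variable {F : Type*} [Field F] {I J K R : ℕ}

theorem det_submatrix_eq_zero_of_rank_lt {m : ℕ} {G : Matrix (Fin I) (Fin J) F}
    (hG : G.rank < m) (i : Fin m → Fin I) (j : Fin m → Fin J) : (G.submatrix i j).det = 0 := by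
  by_contra h
  have h1 := Matrix.rank_of_det_ne_zero h
  have h2 := Matrix.rank_submatrix_le G i j
  rw [h1, Fintype.card_fin] at h2
  omega

theorem det_sum_columns {m : ℕ} (M : Fin m → Fin R → Fin m → F) :
    (Matrix.of fun p q => ∑ t, M p t q).det =
      ∑ s : Fin m → Fin R, (Matrix.of fun p q => M p (s q) q).det := by
  have := (Matrix.detRowAlternating (n := Fin m) (R := F)).toMultilinearMap.map_sum
    (fun (q : Fin m) (t : Fin R) (p : Fin m) => M p t q)
  rw [← Matrix.det_transpose]
  convert this using 1
  · change _ = Matrix.det _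
    congr 1
    ext q p
    simp
  · refine Finset.sum_congr rfl fun s _ => ?_
    rw [← Matrix.det_transpose]
    rfl

/-- The weighted sum of products of minors that appears in the Cauchy-Binet formula vanishes
for a matrix of small rank. -/
theorem sum_det_mul_det_eq_zero {m : ℕ} {A : Matrix (Fin I) (Fin R) F}
    {B : Matrix (Fin J) (Fin R) F} {v : Fin R → F}
    (hG : (A * Matrix.diagonal v * B.transpose).rank < m) (i : Fin m → Fin I)
    (j : Fin m → Fin J) :
    ∑ s : Fin m → Fin R, (Matrix.of fun p q => A (i p) (s q)).det *
      (Matrix.of fun p q => B (j p) (s q)).det * ∏ q, v (s q) = 0 := by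
  -- For each `π` in the Leibniz expansion of the minor of `B`, the sum over `s` is the column
  -- expansion of a minor of the product, with columns `j ∘ π`; it vanishes by the rank bound.
  have hdet : ∀ π : Equiv.Perm (Fin m), ∑ s : Fin m → Fin R,
      (∏ q, B (j (π q)) (s q) * v (s q)) * (Matrix.of fun p q => A (i p) (s q)).det = 0 := by
    intro π
    rw [← det_submatrix_eq_zero_of_rank_lt hG i (j ∘ π)]
    have : (A * Matrix.diagonal v * B.transpose).submatrix i (j ∘ π) =
        Matrix.of fun p q => ∑ t, B (j (π q)) t * v t * A (i p) t := by
      ext p q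
      rw [Matrix.submatrix_apply, Matrix.mul_apply]
      simp only [Matrix.mul_diagonal, Matrix.transpose_apply, Function.comp_apply,
        Matrix.of_apply]
      exact Finset.sum_congr rfl fun t _ => by ring
    rw [this, det_sum_columns (fun p t q => B (j (π q)) t * v t * A (i p) t)]
    refine Finset.sum_congr rfl fun s _ => ?_
    rw [← Matrix.det_mul_row]
    rfl
  calc _ = ∑ s : Fin m → Fin R, ∑ π : Equiv.Perm (Fin m), ((Equiv.Perm.sign π : ℤ) : F) *
        ((∏ q, B (j (π q)) (s q) * v (s q)) * (Matrix.of fun p q => A (i p) (s q)).det) := by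
        refine Finset.sum_congr rfl fun s _ => ?_
        rw [Matrix.det_apply' (Matrix.of fun p q => B (j p) (s q)), Finset.mul_sum,
          Finset.sum_mul]
        refine Finset.sum_congr rfl fun π _ => ?_
        rw [Finset.prod_mul_distrib]
        simp only [Matrix.of_apply]
        ring
    _ = 0 := by
        rw [Finset.sum_comm]
        refine Finset.sum_eq_zero fun π _ => ?_
        rw [← Finset.mul_sum, hdet, mul_zero]

/-- Summing over sorted tuples and then over their rearrangements is summing over all
tuples. -/
theorem sum_tuple_rearrangements (m l : ℕ) (w : (Fin (m + l) → Fin R) → F)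
    (hw : ∀ s, (Finset.univ.image s).card < m → w s = 0) :
    ∑ r : Tuple m l R, ∑ s ∈ Finset.univ.image
      (fun π : Equiv.Perm (Fin (m + l)) => r.1 ∘ π), w s = ∑ s, w s := by
  classical
  rw [← Finset.sum_biUnion]
  · refine Finset.sum_subset (Finset.subset_univ _) fun s _ hs => hw s ?_
    by_contra hlt
    refine hs (Finset.mem_biUnion.2 ⟨⟨s ∘ _root_.Tuple.sort s,
      fun p q hpq => _root_.Tuple.monotone_sort s hpq, ?_⟩, Finset.mem_univ _,
      Finset.mem_image.2 ⟨(_root_.Tuple.sort s)⁻¹, Finset.mem_univ _, ?_⟩⟩)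
    · rw [← Finset.image_image, Finset.image_univ_equiv]
      omega
    · ext p
      simp
  · intro r _ r' _ hne
    refine Finset.disjoint_left.2 fun s hs hs' => hne ?_
    obtain ⟨π, -, rfl⟩ := Finset.mem_image.1 hs
    obtain ⟨π', -, h⟩ := Finset.mem_image.1 hs'
    have hr : r.1 = r'.1 ∘ (π' * π⁻¹ : Equiv.Perm _) := by
      ext p
      have := congrFun h (π.symm p)
      simp only [Function.comp_apply, Equiv.apply_symm_apply] at this
      rw [← this]
      rfl
    have hmono : Monotone (r'.1 ∘ (π' * π⁻¹ : Equiv.Perm _)) := hr ▸ fun p q h => r.2.1 p q h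
    have hmono' : Monotone (r'.1 ∘ (1 : Equiv.Perm (Fin (m + l)))) := fun p q h => r'.2.1 p q h
    exact Subtype.ext (hr.trans (_root_.Tuple.unique_monotone hmono hmono'))

theorem det_eq_zero_of_card_image_lt {m l : ℕ} (A : Matrix (Fin I) (Fin R) F)
    (i : Fin m → Fin I) {s : Fin (m + l) → Fin R} (hs : (Finset.univ.image s).card < m) :
    (Matrix.of fun p q : Fin m => A (i p) (s (Fin.castAdd l q))).det = 0 := by
  have hninj : ¬ Function.Injective fun q : Fin m => s (Fin.castAdd l q) := fun hinj => by
    have h1 := Finset.card_image_of_injective Finset.univ hinj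
    have h2 : Finset.univ.image (fun q : Fin m => s (Fin.castAdd l q)) ⊆ Finset.univ.image s := by
      intro x hx
      obtain ⟨q, -, rfl⟩ := Finset.mem_image.1 hx
      exact Finset.mem_image_of_mem _ (Finset.mem_univ _)
    have h3 := Finset.card_le_card h2
    rw [h1, Finset.card_univ, Fintype.card_fin] at h3
    omega
  simp only [Function.Injective, not_forall] at hninj
  obtain ⟨p, q, hpq, hne⟩ := hninj
  exact Matrix.det_zero_of_column_eq hne fun k => by simp [hpq]

/-- The monomials of degree `m + l` in the entries of `v`. -/
def monomials (m l : ℕ) (v : Fin R → F) : Tuple m l R → F :=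
  fun r => ∏ p, v (r.1 p)

/-- A monomial is invariant under rearrangement, so each entry becomes a sum over all tuples. With
the last `l` indices fixed, the sum over the first `m` is of Cauchy-Binet type and vanishes. -/
theorem Phi_mulVec_monomials {m l : ℕ} {A : Matrix (Fin I) (Fin R) F}
    {B : Matrix (Fin J) (Fin R) F} {v : Fin R → F}
    (hG : (A * Matrix.diagonal v * B.transpose).rank < m) :
    (Phi m l A B).mulVec (monomials m l v) = 0 := by
  classical
  ext ⟨i, j⟩
  set w : (Fin (m + l) → Fin R) → F := fun s =>
    (Matrix.of fun p q : Fin m => A (i (Fin.castAdd l p)) (s (Fin.castAdd l q))).det *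
      (Matrix.of fun p q : Fin m => B (j (Fin.castAdd l p)) (s (Fin.castAdd l q))).det *
      (∏ p : Fin l, A (i (Fin.natAdd m p)) (s (Fin.natAdd m p))) *
      (∏ p : Fin l, B (j (Fin.natAdd m p)) (s (Fin.natAdd m p))) * ∏ p, v (s p) with hw
  have h1 : ∑ s, w s = 0 := by
    rw [← (Fin.appendEquiv m l).sum_comp, Fintype.sum_prod_type, Finset.sum_comm]
    refine Finset.sum_eq_zero fun t _ => ?_
    have := sum_det_mul_det_eq_zero hG (fun p => i (Fin.castAdd l p))
      (fun p => j (Fin.castAdd l p))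
    rw [← mul_zero ((∏ p : Fin l, A (i (Fin.natAdd m p)) (t p)) *
      (∏ p : Fin l, B (j (Fin.natAdd m p)) (t p)) * ∏ p, v (t p)), ← this, Finset.mul_sum]
    refine Finset.sum_congr rfl fun s _ => ?_
    simp only [hw, Fin.appendEquiv, Equiv.coe_fn_mk, Fin.append_left, Fin.append_right,
      Fin.prod_univ_add]
    ring
  have h2 := sum_tuple_rearrangements m l w fun s hs => by
    simp only [hw]
    rw [det_eq_zero_of_card_image_lt A _ hs]
    ring
  rw [h1] at h2
  rw [Pi.zero_apply, ← mul_zero (1 / ((m.factorial : F)) ^ 2), ← h2, Finset.mul_sum]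
  refine Finset.sum_congr rfl fun r _ => ?_
  simp only [Phi, Matrix.of_apply]
  rw [mul_assoc, Finset.sum_mul]
  congr 1
  refine Finset.sum_congr rfl fun s hs => ?_
  obtain ⟨π, -, rfl⟩ := Finset.mem_image.1 hs
  simp only [hw, monomials, Function.comp_apply]
  rw [Equiv.prod_comp π fun p => v (r.1 p)]

/-- The monomial vector of $C^Tx$ is $S^T(x\otimes\dots\otimes x)$: all permutations in the
symmetrization contribute equally. Characteristic zero makes the average meaningful. -/
theorem monomials_mem_span [CharZero F] (m l : ℕ) (C : Matrix (Fin K) (Fin R) F) (x : Fin K → F) :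
    monomials m l (fun r => ∑ k, C k r * x k) ∈
      Submodule.span F (Set.range (S m l C).transpose.col) := by
  have : monomials m l (fun r => ∑ k, C k r * x k) =
      ∑ k : Fin (m + l) → Fin K, (∏ p, x (k p)) • (S m l C).transpose.col k := by
    ext r
    simp only [Finset.sum_apply, Pi.smul_apply, smul_eq_mul, Matrix.col_apply,
      Matrix.transpose_apply, S, Matrix.of_apply]
    have hfac : ((m + l).factorial : F) ≠ 0 := Nat.cast_ne_zero.2 (Nat.factorial_ne_zero _)
    have hπ : ∀ π : Equiv.Perm (Fin (m + l)),
        ∑ k : Fin (m + l) → Fin K, ∏ p, C (k p) (r.1 (π p)) * x (k p) =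
          monomials m l (fun r => ∑ k, C k r * x k) r := by
      intro π
      rw [monomials, ← Equiv.prod_comp π, Finset.prod_univ_sum, Fintype.piFinset_univ]
    calc _ = (1 / ((m + l).factorial : F)) * ∑ π : Equiv.Perm (Fin (m + l)),
          ∑ k : Fin (m + l) → Fin K, ∏ p, C (k p) (r.1 (π p)) * x (k p) := by
          simp only [hπ, Finset.sum_const, Finset.card_univ, Fintype.card_perm, Fintype.card_fin,
            nsmul_eq_mul]
          field_simp
      _ = _ := by
          rw [Finset.sum_comm, Finset.mul_sum]
          refine Finset.sum_congr rfl fun k _ => ?_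
          simp only [Finset.prod_mul_distrib]
          rw [← Finset.sum_mul]
          ring
  rw [this]
  exact Submodule.sum_mem _ fun k _ => Submodule.smul_mem _ _ (Submodule.subset_span ⟨k, rfl⟩)

open Classical in
theorem card_support_lt_of_monomials_eq_zero {m l : ℕ} (hm : 1 ≤ m) {v : Fin R → F}
    (h : monomials m l v = 0) : (Finset.univ.filter fun r => v r ≠ 0).card < m := by
  by_contra hlt
  obtain ⟨s, hs, hcard⟩ := Finset.exists_subset_card_eq (not_lt.1 hlt)
  have hlast : m - 1 < m := by omega
  -- List `m` indices with nonzero entries increasingly and repeat the last one `l` times: an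
  -- admissible tuple whose monomial would be nonzero.
  set r : Fin (m + l) → Fin R := fun p =>
    s.orderEmbOfFin hcard ⟨min p.1 (m - 1), (min_le_right _ _).trans_lt hlast⟩ with hr
  have hmono : ∀ p q, p ≤ q → r p ≤ r q := fun p q hpq =>
    (s.orderEmbOfFin hcard).monotone (Fin.mk_le_mk.2 (min_le_min_right _ hpq))
  have himage : s ⊆ Finset.univ.image r := by
    intro t ht
    have : t ∈ Set.range (s.orderEmbOfFin hcard) := by
      rw [Finset.range_orderEmbOfFin]
      exact ht
    obtain ⟨p, rfl⟩ := this
    refine Finset.mem_image.2 ⟨Fin.castAdd l p, Finset.mem_univ _, ?_⟩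
    simp only [hr]
    congr 1
    ext
    simp only [Fin.val_castAdd]
    omega
  have h0 := congrFun h ⟨r, hmono, hcard.symm.le.trans (Finset.card_le_card himage)⟩
  simp only [monomials, Pi.zero_apply, Finset.prod_eq_zero_iff] at h0
  obtain ⟨p, -, hp⟩ := h0
  exact (Finset.mem_filter.1 (hs (s.orderEmbOfFin_mem hcard _))).2 hp

open Classical in
/-- If `Φ_{m,l}(A, B) U` has full column rank, then a matrix `A diag(Cᵀ x) Bᵀ` of rank less than
`m` comes from a vector `Cᵀ x` with fewer than `m` nonzero entries. -/
theorem card_support_lt_of_rank_lt [CharZero F] {m l d : ℕ} (hm : 1 ≤ m)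
    {A : Matrix (Fin I) (Fin R) F} {B : Matrix (Fin J) (Fin R) F} {C : Matrix (Fin K) (Fin R) F}
    {U : Matrix (Tuple m l R) (Fin d) F} (hU : ColumnsFormBasisOfRange U (S m l C).transpose)
    (hΦ : FullColumnRank (Phi m l A B * U)) (x : Fin K → F)
    (hG : (A * Matrix.diagonal (fun r => ∑ k, C k r * x k) * B.transpose).rank < m) :
    (Finset.univ.filter fun r => ∑ k, C k r * x k ≠ 0).card < m := by
  refine card_support_lt_of_monomials_eq_zero (l := l) hm ?_
  have hmem := monomials_mem_span m l C x
  rw [← hU.2, ← Matrix.range_mulVecLin] at hmem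
  obtain ⟨y, hy⟩ := hmem
  rw [Matrix.mulVecLin_apply] at hy
  have h0 := Phi_mulVec_monomials (l := l) hG
  rw [← hy, Matrix.mulVec_mulVec] at h0
  have hy0 : y = 0 := Matrix.mulVec_injective_iff.2 hΦ (by rw [h0, Matrix.mulVec_zero])
  rw [← hy, hy0, Matrix.mulVec_zero]

theorem dual_apply_eq_sum (f : Dual F (Fin K → F)) (v : Fin K → F) :
    f v = ∑ k, v k * f (Pi.single k 1) := by
  rw [LinearMap.pi_apply_eq_sum_univ f v]
  simp only [smul_eq_mul]
  refine Finset.sum_congr rfl fun k _ => ?_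
  congr 2
  ext j
  simp [Pi.single_apply, eq_comm]

/-- A functional dual to the column `e` of `B` on the support of `v` maps to `v e` times the column
`e` of `A`, so the range contains all the independent columns of `A` on that support. -/
theorem card_le_rank_mul_diagonal_mul [DecidableEq F] {A : Matrix (Fin I) (Fin R) F}
    {B : Matrix (Fin J) (Fin R) F} (v : Fin R → F)
    (hA : LinearIndepOn F A.col (Finset.univ.filter fun r => v r ≠ 0 : Finset (Fin R)))
    (hB : LinearIndepOn F B.col (Finset.univ.filter fun r => v r ≠ 0 : Finset (Fin R))) :
    (Finset.univ.filter fun r => v r ≠ 0).card ≤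
      (A * Matrix.diagonal v * B.transpose).rank := by
  set s := Finset.univ.filter fun r => v r ≠ 0 with hs
  have hmem : ∀ e ∈ s,
      A.col e ∈ LinearMap.range (A * Matrix.diagonal v * B.transpose).mulVecLin := by
    intro e he
    obtain ⟨g, hg, hg0⟩ := exists_dual_of_linearIndepOn hB he
    have hve : v e ≠ 0 := (Finset.mem_filter.1 he).2
    have hBg : ∀ r, (B.transpose.mulVec fun j => g (Pi.single j 1)) r = g (B.col r) := by
      intro r
      rw [dual_apply_eq_sum g (B.col r)]
      rfl
    refine ⟨(v e)⁻¹ • fun j => g (Pi.single j 1), ?_⟩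
    rw [map_smul, Matrix.mulVecLin_apply, ← Matrix.mulVec_mulVec, ← Matrix.mulVec_mulVec]
    ext i
    change (v e)⁻¹ * ∑ r, A i r * (Matrix.diagonal v).mulVec
      (B.transpose.mulVec fun j => g (Pi.single j 1)) r = A i e
    simp only [Matrix.mulVec_diagonal, hBg]
    rw [Finset.sum_eq_single e]
    · rw [hg]
      field_simp
    · intro r _ hre
      by_cases hr : v r = 0
      · simp [hr]
      · rw [hg0 r (by simp [hs, hr]) hre, mul_zero, mul_zero]
    · simp
  rw [Matrix.rank]
  have h1 := finrank_span_eq_card hA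
  rw [← Set.image_eq_range] at h1
  have h2 : Submodule.span F (A.col '' (s : Set (Fin R))) ≤
      LinearMap.range (A * Matrix.diagonal v * B.transpose).mulVecLin := by
    rw [Submodule.span_le]
    rintro _ ⟨e, he, rfl⟩
    exact hmem e he
  have h3 := Submodule.finrank_mono h2
  rw [h1] at h3
  simpa using h3

theorem rank_mul_diagonal_mul_le [DecidableEq F] (A : Matrix (Fin I) (Fin R) F)
    (B : Matrix (Fin J) (Fin R) F) (v : Fin R → F) :
    (A * Matrix.diagonal v * B.transpose).rank ≤ (Finset.univ.filter fun r => v r ≠ 0).card := by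
  refine (Matrix.rank_mul_le_left _ _).trans ((Matrix.rank_mul_le_right _ _).trans ?_)
  rw [Matrix.rank_diagonal, Fintype.card_subtype]

end CompoundMatrices

/-! ### Uniqueness of the third factor, then of all terms. -/

section Uniqueness

variable {F : Type*} [Field F] {I J K R R' : ℕ}

/-- The contraction of `[A, B, C]_R` with a functional in the third mode. -/
theorem mul_diagonal_mul_eq_contract (A : Matrix (Fin I) (Fin R) F) (B : Matrix (Fin J) (Fin R) F)
    (C : Matrix (Fin K) (Fin R) F) (f : Dual F (Fin K → F)) :
    A * Matrix.diagonal (fun r => f (C.col r)) * B.transpose =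
      Matrix.of fun i j => ∑ k, polyadic A B C i j k * f (Pi.single k 1) := by
  ext i j
  rw [Matrix.mul_apply]
  simp only [Matrix.mul_diagonal, Matrix.transpose_apply, Matrix.of_apply, polyadic,
    Finset.sum_mul]
  rw [Finset.sum_comm]
  refine Finset.sum_congr rfl fun r _ => ?_
  rw [dual_apply_eq_sum f (C.col r), Finset.mul_sum, Finset.sum_mul]
  exact Finset.sum_congr rfl fun k _ => by rw [Matrix.col_apply]; ring

theorem contract_first_third (A : Matrix (Fin I) (Fin R) F) (B : Matrix (Fin J) (Fin R) F)
    (C : Matrix (Fin K) (Fin R) F) (f : Dual F (Fin K → F)) (g : Dual F (Fin I → F)) :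
    ∑ s, (f (C.col s) * g (A.col s)) • B.col s =
      fun j => ∑ i, (∑ k, polyadic A B C i j k * f (Pi.single k 1)) * g (Pi.single i 1) := by
  ext j
  have h : ∀ i, ∑ k, polyadic A B C i j k * f (Pi.single k 1) =
      ∑ s, A i s * f (C.col s) * B j s := fun i => by
    have := congrFun (congrFun (mul_diagonal_mul_eq_contract A B C f) i) j
    rw [Matrix.mul_apply] at this
    simpa only [Matrix.mul_diagonal, Matrix.transpose_apply, Matrix.of_apply] using this.symm
  simp only [h, Finset.sum_mul]
  rw [Finset.sum_comm, Finset.sum_apply]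
  refine Finset.sum_congr rfl fun s _ => ?_
  rw [dual_apply_eq_sum g (A.col s), Finset.mul_sum]
  simp only [Pi.smul_apply, smul_eq_mul, Finset.sum_mul, Matrix.col_apply]
  exact Finset.sum_congr rfl fun i _ => by ring

theorem polyadic_swap (A : Matrix (Fin I) (Fin R) F) (B : Matrix (Fin J) (Fin R) F)
    (C : Matrix (Fin K) (Fin R) F) (i : Fin I) (j : Fin J) (k : Fin K) :
    polyadic B A C j i k = polyadic A B C i j k :=
  Finset.sum_congr rfl fun r _ => by ring

/-- Two decompositions whose third factors agree up to permutation and scaling have the same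
terms, if `min(k_A, k_B - 1) + k_C ≥ R + 1`. -/
theorem exists_scalings_of_third_factor {A A' : Matrix (Fin I) (Fin R) F}
    {B B' : Matrix (Fin J) (Fin R) F} {C C' : Matrix (Fin K) (Fin R) F}
    (hT : polyadic A B C = polyadic A' B' C')
    (hk : (R : ℤ) + 1 ≤ min (kRank A : ℤ) ((kRank B : ℤ) - 1) + (kRank C : ℤ))
    (σ : Equiv.Perm (Fin R)) {γ : Fin R → F} (hγ : ∀ r, γ r ≠ 0)
    (hC : ∀ r, C'.col r = γ r • C.col (σ r)) :
    ∃ α β : Fin R → F, ∀ r, α r * β r * γ r = 1 ∧ A'.col r = α r • A.col (σ r) ∧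
      B'.col r = β r • B.col (σ r) := by
  have hCR := (kRank_spec C).1
  have hBR := (kRank_spec B).1
  -- Reindexing by `σ⁻¹` and moving `γ` into the first factor makes the third factors equal. This
  -- `q` is the least one for which the k-rank of `C` gives the independence required of `c`.
  obtain ⟨β, hβ⟩ := exists_scalars_of_third_factor_eq (F := F) (q := R + 1 - kRank C)
    (a := A.col) (b := B.col) (c := C.col)
    (a' := fun s => γ (σ.symm s) • A'.col (σ.symm s)) (b' := fun s => B'.col (σ.symm s))
    (by omega) (by omega)
    (fun s hs => linearIndepOn_of_card_le_kRank (by omega))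
    (fun s hs => linearIndepOn_of_card_le_kRank (by omega))
    (fun s hs => linearIndepOn_of_card_le_kRank (by omega))
    (fun f g => by
      rw [contract_first_third, hT, ← contract_first_third]
      refine Eq.trans ?_ (Equiv.sum_comp σ _)
      refine Finset.sum_congr rfl fun s _ => ?_
      simp only [Equiv.symm_apply_apply, hC, map_smul, smul_eq_mul]
      congr 1
      ring)
  refine ⟨fun r => (γ r)⁻¹ * (β (σ r))⁻¹, fun r => β (σ r), fun r => ?_⟩
  dsimp only
  obtain ⟨h0, hb, ha⟩ := hβ (σ r)
  have hr := hγ r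
  simp only [Equiv.symm_apply_apply] at hb ha
  refine ⟨by field_simp, ?_, hb⟩
  rw [ha, smul_smul, smul_smul,
    show (γ r)⁻¹ * (β (σ r))⁻¹ * β (σ r) * γ r = 1 by field_simp, one_smul]

theorem eq_zero_of_forall_col {C : Matrix (Fin K) (Fin R) F} (hC : C.rank = K)
    {f : Dual F (Fin K → F)} (hf : ∀ r, f (C.col r) = 0) : f = 0 := by
  have htop : Submodule.span F (Set.range C.col) = ⊤ := by
    refine Submodule.eq_top_of_finrank_eq ?_
    rw [← Matrix.rank_eq_finrank_span_cols, hC]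
    simp
  have hle : Submodule.span F (Set.range C.col) ≤ LinearMap.ker f := by
    rw [Submodule.span_le]
    rintro _ ⟨r, rfl⟩
    exact hf r
  rw [htop, top_le_iff] at hle
  exact LinearMap.ker_eq_top.1 hle

/-- A functional vanishing on all columns of `C'` contracts the tensor to zero. Independence of the
Khatri-Rao columns makes it vanish on the columns of `C`, which span. -/
theorem span_col_eq_top {A : Matrix (Fin I) (Fin R) F} {B : Matrix (Fin J) (Fin R) F}
    {C : Matrix (Fin K) (Fin R) F} {A' : Matrix (Fin I) (Fin R') F}
    {B' : Matrix (Fin J) (Fin R') F} {C' : Matrix (Fin K) (Fin R') F}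
    (hT : polyadic A B C = polyadic A' B' C') (hC : C.rank = K)
    (hAB : FullColumnRank (khatriRao A B)) : Submodule.span F (Set.range C'.col) = ⊤ := by
  by_contra hne
  obtain ⟨x, -, hx⟩ := SetLike.exists_of_lt (lt_top_iff_ne_top.2 hne)
  obtain ⟨f, hf, hle⟩ := Submodule.exists_le_ker_of_notMem hx
  refine hf ?_
  have hf' : ∀ r, f (C'.col r) = 0 := fun r => hle (Submodule.subset_span ⟨r, rfl⟩)
  have h0 : A * Matrix.diagonal (fun r => f (C.col r)) * B.transpose = 0 := by
    rw [mul_diagonal_mul_eq_contract, hT, ← mul_diagonal_mul_eq_contract]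
    simp [hf']
  have hv : (khatriRao A B).mulVec (fun r => f (C.col r)) = 0 := by
    ext ⟨i, j⟩
    have := congrFun (congrFun h0 i) j
    rw [Matrix.mul_apply] at this
    simp only [Matrix.mul_diagonal, Matrix.transpose_apply, Matrix.zero_apply] at this
    rw [Pi.zero_apply, ← this]
    simp only [Matrix.mulVec, dotProduct, khatriRao, Matrix.of_apply]
    exact Finset.sum_congr rfl fun r _ => by ring
  have hz := Matrix.mulVec_injective_iff.2 hAB (hv.trans (Matrix.mulVec_zero _).symm)
  rw [eq_zero_of_forall_col hC (congrFun hz), LinearMap.zero_apply]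

open Classical in
/-- Uniqueness of the third factor matrix, and minimality of the number of terms. -/
theorem third_factor_unique {A : Matrix (Fin I) (Fin R) F} {B : Matrix (Fin J) (Fin R) F}
    {C : Matrix (Fin K) (Fin R) F} {A' : Matrix (Fin I) (Fin R') F}
    {B' : Matrix (Fin J) (Fin R') F} {C' : Matrix (Fin K) (Fin R') F}
    (hT : polyadic A B C = polyadic A' B' C') (hR : R' ≤ R) (hC : C.rank = K) (hKR : K ≤ R)
    (hAB : FullColumnRank (khatriRao A B)) (hkA : R - K + 1 ≤ kRank A)
    (hkB : R - K + 1 ≤ kRank B) (hkC : 2 ≤ kRank C)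
    (hsupp : ∀ x : Fin K → F,
      (A * Matrix.diagonal (fun r => ∑ k, C k r * x k) * B.transpose).rank < R - K + 2 →
      (Finset.univ.filter fun r => ∑ k, C k r * x k ≠ 0).card < R - K + 2) :
    R' = R ∧ ∃ σ : Fin R' → Fin R, Function.Injective σ ∧
      ∀ r, ∃ γ : F, γ ≠ 0 ∧ C'.col r = γ • C.col (σ r) := by
  refine exists_equiv_smul (span_col_eq_top hT hC hAB) hR
    (col_ne_zero_of_one_le_kRank (by omega)) (eq_of_mem_span_singleton_of_two_le_kRank hkC)
    fun f hf => ?_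
  rw [Module.finrank_fin_fun] at hf
  have hle := rank_mul_diagonal_mul_le A' B' fun r => f (C'.col r)
  rw [mul_diagonal_mul_eq_contract, ← hT, ← mul_diagonal_mul_eq_contract] at hle
  have hcard := hsupp fun k => f (Pi.single k 1)
  have hdual : (fun r => ∑ k, C k r * f (Pi.single k 1)) = fun r => f (C.col r) :=
    funext fun r => (dual_apply_eq_sum f (C.col r)).symm
  have hdual' : ∀ r, ∑ k, C k r * f (Pi.single k 1) = f (C.col r) := congrFun hdual
  simp only [hdual'] at hcard
  have hlt := hcard (by omega)
  refine le_trans (card_le_rank_mul_diagonal_mul _ ?_ ?_) hle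
  · exact linearIndepOn_of_card_le_kRank (by omega)
  · exact linearIndepOn_of_card_le_kRank (by omega)

end Uniqueness

end CPD

theorem mainTheorem5 {𝕜 : Type*} [RCLike 𝕜] {I J K R : ℕ}
    (T : Fin I → Fin J → Fin K → 𝕜)
    (A : Matrix (Fin I) (Fin R) 𝕜) (B : Matrix (Fin J) (Fin R) 𝕜)
    (C : Matrix (Fin K) (Fin R) 𝕜)
    (hT : T = CPD.polyadic A B C)
    (hC : C.rank = K) (hKR : K ≤ R)
    (hABC : CPD.Assumptions₁ A B C ∨ CPD.Assumptions₂ A B C)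
    (hk : (R : ℤ) + 1 ≤
      max (min (CPD.kRank A : ℤ) ((CPD.kRank B : ℤ) - 1))
          (min ((CPD.kRank A : ℤ) - 1) (CPD.kRank B : ℤ)) + (CPD.kRank C : ℤ)) :
    CPD.tensorRank T = R ∧ CPD.CPDIsUnique T := by
  classical
  have hA := (CPD.kRank_spec A).1
  have hB := (CPD.kRank_spec B).1
  have hCK := CPD.kRank_le_height C
  -- The maximum in `hk` is at most `R - 1`, since neither k-rank exceeds `R`. It is also at most
  -- each of the two k-ranks, which with `kRank C ≤ K` gives the next two bounds.
  have hkC : 2 ≤ CPD.kRank C := by omega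
  have hkA : R - K + 1 ≤ CPD.kRank A := by omega
  have hkB : R - K + 1 ≤ CPD.kRank B := by omega
  have hAB : CPD.FullColumnRank (CPD.khatriRao A B) := hABC.elim (fun h => h.2.1) fun h => h.2.1
  obtain ⟨l, d, U, hU, hΦ⟩ : ∃ (l d : ℕ)
      (U : Matrix (CPD.Tuple (R - K + 2) l R) (Fin d) 𝕜),
      CPD.ColumnsFormBasisOfRange U (CPD.S (R - K + 2) l C).transpose ∧
      CPD.FullColumnRank (CPD.Phi (R - K + 2) l A B * U) := by
    rcases hABC with ⟨-, -, l, d, U, h⟩ | ⟨-, -, -, h⟩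
    -- The last element of `Fin (R - K + 2)` stands for `p = m`.
    · exact ⟨_, _, _, h (Fin.last (R - K + 1))⟩
    · exact h
  have hsupp := CPD.card_support_lt_of_rank_lt (by omega) hU hΦ
  have hmatch : ∀ {n : ℕ} {A' : Matrix (Fin I) (Fin n) 𝕜} {B' : Matrix (Fin J) (Fin n) 𝕜}
      {C' : Matrix (Fin K) (Fin n) 𝕜}, n ≤ R → T = CPD.polyadic A' B' C' → n = R ∧
      ∃ σ : Fin n → Fin R, Function.Injective σ ∧
      ∀ r, ∃ γ : 𝕜, γ ≠ 0 ∧ C'.col r = γ • C.col (σ r) := fun hn h =>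
    CPD.third_factor_unique (hT.symm.trans h) hn hC hKR hAB hkA hkB hkC hsupp
  have hPD : CPD.IsPD T A B C := ⟨hT, fun r =>
    ⟨CPD.col_ne_zero_of_one_le_kRank (by omega) r, CPD.col_ne_zero_of_one_le_kRank (by omega) r,
      CPD.col_ne_zero_of_one_le_kRank (by omega) r⟩⟩
  have hrank : CPD.tensorRank T = R := by
    have hle : CPD.tensorRank T ≤ R := Nat.sInf_le ⟨A, B, C, hPD⟩
    obtain ⟨A', B', C', h, -⟩ := Nat.sInf_mem (s := {n : ℕ | ∃ (A : Matrix (Fin I) (Fin n) 𝕜)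
      (B : Matrix (Fin J) (Fin n) 𝕜) (C : Matrix (Fin K) (Fin n) 𝕜), CPD.IsPD T A B C})
      ⟨R, A, B, C, hPD⟩
    exact (hmatch hle h).1
  refine ⟨hrank, fun n A₁ A₂ B₁ B₂ C₁ C₂ h₁ h₂ => ?_⟩
  obtain rfl : n = R := h₁.2.trans hrank
  have hterms : ∀ {A' : Matrix (Fin I) (Fin n) 𝕜} {B' : Matrix (Fin J) (Fin n) 𝕜}
      {C' : Matrix (Fin K) (Fin n) 𝕜}, T = CPD.polyadic A' B' C' →
      ∃ (σ : Equiv.Perm (Fin n)) (α β γ : Fin n → 𝕜), ∀ r,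
        α r * β r * γ r = 1 ∧ A'.col r = α r • A.col (σ r) ∧
        B'.col r = β r • B.col (σ r) ∧ C'.col r = γ r • C.col (σ r) := by
    intro A' B' C' h
    obtain ⟨-, σ, hσ, hγ⟩ := hmatch le_rfl h
    choose γ hγ0 hγ using hγ
    let τ : Equiv.Perm (Fin n) := Equiv.ofBijective σ (Finite.injective_iff_bijective.1 hσ)
    rcases le_total (min ((CPD.kRank A : ℤ) - 1) (CPD.kRank B : ℤ))
      (min (CPD.kRank A : ℤ) ((CPD.kRank B : ℤ) - 1)) with hle | hle
    · rw [max_eq_left hle] at hk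
      obtain ⟨α, β, hαβ⟩ := CPD.exists_scalings_of_third_factor (hT.symm.trans h) hk τ hγ0 hγ
      exact ⟨τ, α, β, γ, fun r => ⟨(hαβ r).1, (hαβ r).2.1, (hαβ r).2.2, hγ r⟩⟩
    -- The other branch of the maximum is the same statement with the first two modes exchanged.
    · rw [max_eq_right hle, min_comm] at hk
      have hswap : CPD.polyadic B A C = CPD.polyadic B' A' C' := by
        funext j i k
        rw [CPD.polyadic_swap A B C, CPD.polyadic_swap A' B' C', ← hT, ← h]
      obtain ⟨β, α, hαβ⟩ := CPD.exists_scalings_of_third_factor hswap hk τ hγ0 hγ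
      exact ⟨τ, α, β, γ, fun r =>
        ⟨by rw [mul_comm (α r), (hαβ r).1], (hαβ r).2.2, (hαβ r).2.1, hγ r⟩⟩
  obtain ⟨σ₁, α₁, β₁, γ₁, hs₁⟩ := hterms h₁.1.1
  obtain ⟨σ₂, α₂, β₂, γ₂, hs₂⟩ := hterms h₂.1.1
  -- Both decompositions are matched to `A`, `B`, `C`; passing through these matches the second to
  -- the first, with quotients of the scalars.
  set ρ : Equiv.Perm (Fin n) := σ₂.trans σ₁.symm with hρ
  refine ⟨ρ, fun r => α₂ r * (α₁ (ρ r))⁻¹, fun r => β₂ r * (β₁ (ρ r))⁻¹,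
    fun r => γ₂ r * (γ₁ (ρ r))⁻¹, fun r => ?_⟩
  obtain ⟨e₁, a₁, b₁, c₁⟩ := hs₁ (ρ r)
  obtain ⟨e₂, a₂, b₂, c₂⟩ := hs₂ r
  have hσ : σ₁ (ρ r) = σ₂ r := by simp [hρ]
  rw [hσ] at a₁ b₁ c₁
  have hα : α₁ (ρ r) ≠ 0 := fun h => by simp [h] at e₁
  have hβ : β₁ (ρ r) ≠ 0 := fun h => by simp [h] at e₁
  have hγ : γ₁ (ρ r) ≠ 0 := fun h => by simp [h] at e₁
  refine ⟨?_, ?_, ?_, ?_⟩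
  · calc _ = (α₂ r * β₂ r * γ₂ r) * (α₁ (ρ r) * β₁ (ρ r) * γ₁ (ρ r))⁻¹ := by
          field_simp
      _ = 1 := by rw [e₁, e₂, inv_one, one_mul]
  · rw [a₁, a₂, smul_smul, mul_assoc, inv_mul_cancel₀ hα, mul_one]
  · rw [b₁, b₂, smul_smul, mul_assoc, inv_mul_cancel₀ hβ, mul_one]
  · rw [c₁, c₂, smul_smul, mul_assoc, inv_mul_cancel₀ hγ, mul_one]
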